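/- **Setting.** Let $1\le p\le d$ and let $S_t\in\mathbb R^{d\times d}$ be a positive definite covariance matrix with $S_t=V_t\Lambda_tV_t^{T}$, $\Lambda_t=\mathrm{diag}(\lambda_1\ge\dots\ge\lambda_d)$. Let $\Delta_l,\epsilon_{cov},\sigma>0$ and $\gamma_{cov},\hat\alpha\in(0,1)$. The null hypothesis is that the residual satisfies $r_t\sim N(0,S_t)$. The *sequential privacy scheme* has two phases. 1. *Covariance phase.* The eigenvalues $\lambda_i^{-1/2}$ of $V_t\Lambda_t^{-1/2}V_t^{T}$ are replaced by $\lambda_i^{-1/2}+\ell_i$, where $\ell_1,\dots,\ell_d$ are i.i.d. $\mathrm{Lap}(\Delta_l/\epsilon_{cov})$ and independent of $r_t$, and the eigenvectors are replaced by a (possibly random) orthonormal basis $\hat v_1,\dots,\hat v_d$, for instance the original one. The reduced residual is $\hat\tau^{cov}_t=\big((\lambda_i^{-1/2}+\ell_i)\langle \hat v_i,r_t\rangle\big)_{i\le p}\in\mathbb R^p$. 2. *Residual phase.* $\hat\tau^{res}_t=\hat\tau^{cov}_t+e_t$, where $e_t\sim N(0,\sigma^2I_p)$ is independent of $(r_t,\hat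 v,\ell)$. Write $\chi^2(p,\mu)$ for the non-central $\chi^2$ distribution with $p$ degrees of freedom and non-centrality $\mu$. Let $\chi^{2,NC}_{\hat\alpha}$ be the upper $\hat\alpha$-quantile of $\chi^2(p,\|\hat\tau^{cov}_t\|_2^2)$. The differentially private test raises an alarm if $\|\hat\tau^{res}_t\|_2^2>\sigma^2\chi^{2,NC}_{\hat\alpha}$. For $\tau\in\mathbb R^p$ let $F^{\tau}_{\chi^2,p}$ be the CDF of $\|\tau+e\|_2^2$ with $e\sim N(0,\sigma^2I_p)$, that is, of $\sigma^2$ times a $\chi^2(p,\|\tau\|_2^2/\sigma^2)$ variable. Put $\theta_l=\frac{\Delta_l}{\epsilon_{cov}}\log\frac{d}{\gamma_{cov}}$ and $R_t=\sum_{i=1}^p (r_t^i)^2$, where $r_t^i$ are the coordinates of $r_t$ in an orthonormal basis of $\mathbb R^d$ (for instance the eigenvectors). Let $r_{max}$ be a residual of maximal Euclidean norm among a (possibly random) set of admissible residuals containing $r_t$, and $\hat\tau^{cov}_{max,t}$ a vector of maximal norm among a (possibly random) set of admissible reduced residuals containing $\hat\tau^{cov}_t$. Let $F^{ex}$ be the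 CDF of $\mathrm{Exp}(\epsilon_{cov}/\Delta_l)$ and $F^{gamma}_{r_{max}}$ the CDF of $\mathrm{Gamma}\big(p,\epsilon_{cov}/(\Delta_l\|r_{max}\|_2^2)\big)$ (shape, rate). **Theorem.** Put $$\mathcal E^{max}_I(\hat\alpha)=\big[1-F^{gamma}_{r_{max}}(R_t\theta_l)\big]\big[1-F^{\hat\tau^{cov}_t}_{\chi^2,p}(\sigma^2\chi^{2,NC}_{\hat\alpha})\big]+\big[F^{ex}(\theta_l)\big]^p\big[1-F^{\hat\tau^{cov}_{max,t}}_{\chi^2,p}(\sigma^2\chi^{2,NC}_{\hat\alpha})\big].$$ Under the null hypothesis, the Type-I error rate of the differentially private test is bounded by $\mathcal E^{max}_I(\hat\alpha)$. Precisely, the alarm event is measurable, $\mathcal E^{max}_I(\hat\alpha)$ is integrable, almost surely $$\mathbb P\big[\|\hat\tau^{res}_t\|_2^2>\sigma^2\chi^{2,NC}_{\hat\alpha}\,\big|\,r_t,\hat v,\ell\big]\le\mathcal E^{max}_I(\hat\alpha),$$ for every sub-$\sigma$-algebra $\mathcal G$ of $\sigma(r_t,\hat v,\ell)$ (for instance $\mathcal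 G=\sigma(r_t)$) almost surely $$\mathbb P\big[\|\hat\tau^{res}_t\|_2^2>\sigma^2\chi^{2,NC}_{\hat\alpha}\,\big|\,\mathcal G\big]\le\mathbb E\big[\mathcal E^{max}_I(\hat\alpha)\,\big|\,\mathcal G\big],$$ and unconditionally $\mathbb P\big[\|\hat\tau^{res}_t\|_2^2>\sigma^2\chi^{2,NC}_{\hat\alpha}\big]\le\mathbb E\big[\mathcal E^{max}_I(\hat\alpha)\big]$. -/

import Mathlib

open MeasureTheory ProbabilityTheory
open scoped NNReal

/-- `ℝⁿ` with its Euclidean norm. -/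
abbrev Vec (n : ℕ) : Type := EuclideanSpace ℝ (Fin n)

/-- The Laplace distribution `Lap(b)` with mean `0` and scale `b > 0`,
of density `x ↦ exp (-|x| / b) / (2 b)`. -/
noncomputable def laplaceMeasure (b : ℝ) : Measure ℝ :=
  volume.withDensity fun x => ENNReal.ofReal ((2 * b)⁻¹ * Real.exp (-|x| / b))

/-- The non-central chi-square distribution `χ²(p, μ)` with `p ≥ 1` degrees of freedom and
non-centrality parameter `μ ≥ 0`: the law of `(Z₀ + √μ)² + Z₁² + ⋯ + Z_{p-1}²` for independent
standard normal variables `Z₀, …, Z_{p-1}`. -/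
noncomputable def nonCentralChiSq (p : ℕ) (μ : ℝ) : Measure ℝ :=
  (Measure.pi fun _ : Fin p => gaussianReal 0 1).map fun z =>
    ∑ i : Fin p, (z i + if (i : ℕ) = 0 then Real.sqrt μ else 0) ^ 2

/-- The level-`a` upper quantile of a distribution on `ℝ`: the least `x` such that the
distribution gives mass at most `a` to `(x, ∞)`. -/
noncomputable def upperQuantile (ν : Measure ℝ) (a : ℝ) : ℝ :=
  sInf {x : ℝ | 1 - a ≤ cdf ν x}

/-- The distribution function `F^τ` of the statistic `‖τ + e‖²` with `e ∼ N(0, σ² I_p)`. This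
statistic is distributed as `σ²` times a `χ²(p, ‖τ‖² / σ²)` variable. -/
noncomputable def residualStatCDF {p : ℕ} (σ : ℝ) (τ : Vec p) (x : ℝ) : ℝ :=
  cdf (nonCentralChiSq p (‖τ‖ ^ 2 / σ ^ 2)) (x / σ ^ 2)

/-- `S = V diag(lam) Vᵀ` with the eigenvalues in decreasing order. -/
def IsSpectralDecomposition {d : ℕ} (S : Matrix (Fin d) (Fin d) ℝ) (lam : Fin d → ℝ)
    (V : OrthonormalBasis (Fin d) ℝ (Vec d)) : Prop :=
  Antitone lam ∧ ∀ i, Matrix.toEuclideanLin S (V i) = lam i • V i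

/-- The reduced residual `Ŝ^{-1/2} r ∈ ℝᵖ` under covariance privacy. The eigenvalues
`lam i ^ (-1/2)` of the square-root factor `V diag(lam)^{-1/2} Vᵀ` are replaced by
`lam i ^ (-1/2) + noise i`, the eigenvectors by `Vhat`, and the first `p` principal components
are kept. -/
noncomputable def covResidual {p d : ℕ} (hpd : p ≤ d) (lam : Fin d → ℝ)
    (Vhat : OrthonormalBasis (Fin d) ℝ (Vec d)) (noise : Fin d → ℝ) (r : Vec d) : Vec p :=
  WithLp.toLp 2 fun i : Fin p =>
    ((Real.sqrt (lam (Fin.castLE hpd i)))⁻¹ + noise (Fin.castLE hpd i)) *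
      inner ℝ (Vhat (Fin.castLE hpd i)) r

/-- `χ^{2,NC}_a`: the level-`a` upper quantile of `χ²(p, ‖τ‖²)`. -/
noncomputable def ncQuantile {p : ℕ} (a : ℝ) (τ : Vec p) : ℝ :=
  upperQuantile (nonCentralChiSq p (‖τ‖ ^ 2)) a

/-- The event that the test on the disclosed residual `τ + e` raises an alarm at level `a`. -/
def dpAlarm {Ω : Type*} {p : ℕ} (σ a : ℝ) (τ e : Ω → Vec p) : Set Ω :=
  {ω | σ ^ 2 * ncQuantile a (τ ω) < ‖τ ω + e ω‖ ^ 2}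

/-- `θ_l = (Δ_l / ε_cov) log (d / γ_cov)`. -/
noncomputable def covThreshold (d : ℕ) (Δ ε γ : ℝ) : ℝ :=
  Δ / ε * Real.log (d / γ)

/-- `R_t`: the sum of the squares of the first `p` coordinates of `r` in the orthonormal
basis `B`. -/
noncomputable def residualEnergy {p d : ℕ} (hpd : p ≤ d)
    (B : OrthonormalBasis (Fin d) ℝ (Vec d)) (r : Vec d) : ℝ :=
  ∑ i : Fin p, (inner ℝ (B (Fin.castLE hpd i)) r) ^ 2

/-- `x` is a maximizer of the norm over the set `A`. -/
def IsNormArgmax {E : Type*} [Norm E] (A : Set E) (x : E) : Prop :=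
  x ∈ A ∧ ∀ y ∈ A, ‖y‖ ≤ ‖x‖

/-- The bound
`[1 - F^{gamma}(R θ)] [1 - F^{τ}(σ² χ)] + [F^{ex}(θ)]^p [1 - F^{τmax}(σ² χ)]`, where `F^{gamma}` and
`F^{ex}` are the distribution functions of `Gamma(p, ε / (Δ ‖rmax‖²))` and `Exp(ε / Δ)`
(shape and rate; rate) and `χ` is the level-`a` upper quantile of `χ²(p, ‖τ‖²)`. -/
noncomputable def typeIBound {p d : ℕ} (σ a Δ ε θ R : ℝ) (rmax : Vec d) (τ τmax : Vec p) : ℝ :=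
  (1 - cdf (gammaMeasure p (ε / (Δ * ‖rmax‖ ^ 2))) (R * θ)) *
      (1 - residualStatCDF σ τ (σ ^ 2 * ncQuantile a τ)) +
    (cdf (expMeasure (ε / Δ)) θ) ^ p *
      (1 - residualStatCDF σ τmax (σ ^ 2 * ncQuantile a τ))

/-- The σ-algebra generated by the residual, the disclosed eigenvectors and the eigenvalue
noise, i.e. by everything that precedes the Gaussian phase. -/
noncomputable abbrev covPhase {Ω : Type*} {d : ℕ} (r : Ω → Vec d)
    (Vhat : Ω → OrthonormalBasis (Fin d) ℝ (Vec d)) (L : Fin d → Ω → ℝ) : MeasurableSpace Ω :=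
  MeasurableSpace.comap (fun ω => (r ω, (fun i => Vhat ω i : Fin d → Vec d), fun i => L i ω))
    inferInstance

/-!
Given the outcome `(r, v̂, ℓ)` of the covariance phase, the reduced residual `τ` is fixed and the
Gaussian noise `e` still has its law `N(0, σ² I)`. Hence the conditional alarm probability is
exactly `G τ = 1 - F^τ(σ² χ)` (`condExp_dpAlarm_ae_eq`); this uses the rotation invariance of the
Gaussian, by which the law of `‖τ + e‖²` depends on `‖τ‖` only (`map_norm_add_sq_stdGaussian`).

It remains to see that `G τ ≤ (1 - F^{gamma}(R θ)) G τ + F^{ex}(θ)ᵖ G τmax` almost surely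
(`one_sub_residualStatCDF_le_typeIBound`), which follows from two inequalities.

* `G τ ≤ G τmax`, as `‖τ‖ ≤ ‖τmax‖` and the non-central chi-square distribution is stochastically
  increasing in its non-centrality (`cdf_nonCentralChiSq_antitone`). Conditioning on all coordinates
  but the shifted one reduces this to the fact that the Gaussian mass of an interval decreases as
  its centre moves away from the origin (`gaussianReal_Icc_antitone_shift`).
* `F^{gamma}(R θ) ≤ F^{ex}(θ)ᵖ`. Since `R ≤ ‖r‖² ≤ ‖rmax‖²`, the left side is at most the probability
  that a sum of `p` independent exponential variables stays below `θ`, which forces each of them to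
  stay below `θ` (`cdf_gammaMeasure_natCast_le_cdf_expMeasure_pow`). The gamma distribution is
  meaningful because `r ≠ 0`, hence `rmax ≠ 0`, almost surely: the covariance matrix is positive
  definite.

The bounds given a smaller σ-algebra and the unconditional one follow from the tower property.
-/

/-! ### Erlang distribution functions -/

theorem hasDerivAt_exp_neg_mul_sum_pow_div_factorial (n : ℕ) (r t : ℝ) :
    HasDerivAt
      (fun t => -(Real.exp (-(r * t)) *
        ∑ k ∈ Finset.range (n + 1), (r * t) ^ k / (k.factorial : ℝ)))
      (r * (Real.exp (-(r * t)) * ((r * t) ^ n / (n.factorial : ℝ)))) t := by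
  have hlin : HasDerivAt (fun t : ℝ => r * t) r t := by
    simpa using (hasDerivAt_id t).const_mul r
  have hexp : HasDerivAt (fun t : ℝ => Real.exp (-(r * t))) (Real.exp (-(r * t)) * -r) t :=
    hlin.neg.exp
  induction n with
  | zero =>
    simp only [zero_add, Finset.sum_range_one, pow_zero, Nat.factorial_zero, Nat.cast_one,
      div_one, mul_one]
    convert! hexp.neg using 1
    ring
  | succ n ih =>
    have hterm : HasDerivAt (fun t : ℝ => (r * t) ^ (n + 1) / ((n + 1).factorial : ℝ))
        ((r * t) ^ n / (n.factorial : ℝ) * r) t := by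
      convert! (hlin.pow (n + 1)).div_const ((n + 1).factorial : ℝ) using 1
      have h1 : (n.factorial : ℝ) ≠ 0 := by positivity
      have h2 : (n : ℝ) + 1 ≠ 0 := by positivity
      rw [Nat.factorial_succ]
      push_cast
      field_simp
    convert! ih.sub (hexp.mul hterm) using 1
    · funext s
      simp only [Pi.mul_apply, Pi.sub_apply]
      rw [Finset.sum_range_succ _ (n + 1)]
      ring
    · ring

theorem cdf_gammaMeasure_natCast_succ (n : ℕ) {r x : ℝ} (hr : 0 < r) (hx : 0 ≤ x) :
    cdf (gammaMeasure ((n + 1 : ℕ) : ℝ) r) x =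
      1 - Real.exp (-(r * x)) *
        ∑ k ∈ Finset.range (n + 1), (r * x) ^ k / (k.factorial : ℝ) := by
  have hn : (0 : ℝ) < ((n + 1 : ℕ) : ℝ) := by positivity
  have hint : Integrable (gammaPDFReal ((n + 1 : ℕ) : ℝ) r) := by
    refine ⟨by fun_prop, ?_⟩
    rw [hasFiniteIntegral_iff_ofReal (ae_of_all _ (gammaPDFReal_nonneg hn hr))]
    have := lintegral_gammaPDF_eq_one hn hr
    simp only [gammaPDF] at this
    rw [this]
    exact ENNReal.one_lt_top
  have h0 : ∫ t in Set.Iic 0, gammaPDFReal ((n + 1 : ℕ) : ℝ) r t = 0 := by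
    rw [integral_Iic_eq_integral_Iio]
    refine setIntegral_eq_zero_of_forall_eq_zero fun t ht => ?_
    rw [gammaPDFReal, if_neg (not_le.2 ht)]
  rw [cdf_gammaMeasure_eq_integral hn hr, ← sub_zero (∫ t in Set.Iic x, _), ← h0,
    intervalIntegral.integral_Iic_sub_Iic hint.integrableOn hint.integrableOn]
  have hpdf : Set.EqOn (gammaPDFReal ((n + 1 : ℕ) : ℝ) r)
      (fun t => r * (Real.exp (-(r * t)) * ((r * t) ^ n / (n.factorial : ℝ))))
      (Set.uIcc 0 x) := by
    intro t ht
    rw [Set.uIcc_of_le hx] at ht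
    simp only [gammaPDFReal, if_pos ht.1]
    rw [Real.rpow_natCast, Nat.cast_succ, Real.Gamma_nat_eq_factorial, add_sub_cancel_right,
      Real.rpow_natCast]
    ring
  rw [intervalIntegral.integral_congr hpdf,
    intervalIntegral.integral_eq_sub_of_hasDerivAt
      (fun t _ => hasDerivAt_exp_neg_mul_sum_pow_div_factorial n r t)
      (Continuous.intervalIntegrable (by fun_prop) _ _)]
  have : ∑ k ∈ Finset.range (n + 1), (r * 0) ^ k / (k.factorial : ℝ) = 1 := by
    rw [Finset.sum_range_succ']
    simp
  rw [this]
  simp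
  ring

/-- The Erlang distribution function with shape `n + 1` is at most `xⁿ⁺¹ / (n + 1)!`: the derivative
of the difference is `(1 - e⁻ˣ) xⁿ / n! ≥ 0`. -/
theorem one_sub_exp_neg_mul_sum_le (n : ℕ) {x : ℝ} (hx : 0 ≤ x) :
    1 - Real.exp (-x) * ∑ k ∈ Finset.range (n + 1), x ^ k / (k.factorial : ℝ) ≤
      x ^ (n + 1) / ((n + 1).factorial : ℝ) := by
  have hd : ∀ t : ℝ, HasDerivAt
      (fun t => t ^ (n + 1) / ((n + 1).factorial : ℝ) +
        Real.exp (-t) * ∑ k ∈ Finset.range (n + 1), t ^ k / (k.factorial : ℝ))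
      (t ^ n / (n.factorial : ℝ) - Real.exp (-t) * (t ^ n / (n.factorial : ℝ))) t := by
    intro t
    have h1 := hasDerivAt_exp_neg_mul_sum_pow_div_factorial n 1 t
    simp only [one_mul] at h1
    convert! ((hasDerivAt_pow (n + 1) t).div_const ((n + 1).factorial : ℝ)).sub h1 using 1
    · funext s
      simp
    · have h1 : (n.factorial : ℝ) ≠ 0 := by positivity
      have h2 : (n : ℝ) + 1 ≠ 0 := by positivity
      rw [Nat.factorial_succ]
      push_cast
      field_simp
  have hmono := monotoneOn_of_hasDerivWithinAt_nonneg (convex_Ici (0 : ℝ))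
    (fun t _ => (hd t).continuousAt.continuousWithinAt)
    (fun t _ => (hd t).hasDerivWithinAt) (fun t ht => by
      rw [interior_Ici] at ht
      have ht' : (0 : ℝ) < t := ht
      have : Real.exp (-t) ≤ 1 := Real.exp_le_one_iff.2 (by linarith)
      have h2 : 0 ≤ t ^ n / (n.factorial : ℝ) := by positivity
      nlinarith)
  have h := hmono (Set.mem_Ici.2 le_rfl) (Set.mem_Ici.2 hx) hx
  have : ∑ k ∈ Finset.range (n + 1), (0 : ℝ) ^ k / (k.factorial : ℝ) = 1 := by
    rw [Finset.sum_range_succ']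
    simp
  simp only [this] at h
  simp at h
  linarith

/-- A sum of `n + 1` independent standard exponentials is at most `x` only if each of them is.
Analytically, with `Fₙ` the Erlang distribution function of shape `n`, the inequality
`Fₙ₊₁ ≤ Fₙ (1 - e⁻ˣ)` amounts to `Fₙ ≤ xⁿ / n!`, because `Fₙ - Fₙ₊₁ = e⁻ˣ xⁿ / n!`. -/
theorem erlang_le_one_sub_exp_neg_pow (n : ℕ) {x : ℝ} (hx : 0 ≤ x) :
    1 - Real.exp (-x) * ∑ k ∈ Finset.range (n + 1), x ^ k / (k.factorial : ℝ) ≤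
      (1 - Real.exp (-x)) ^ (n + 1) := by
  induction n with
  | zero => simp
  | succ n ih =>
    have h1 := one_sub_exp_neg_mul_sum_le n hx
    have h2 : 0 ≤ 1 - Real.exp (-x) := by
      have : Real.exp (-x) ≤ 1 := Real.exp_le_one_iff.2 (by linarith)
      linarith
    have h3 := mul_le_mul_of_nonneg_right ih h2
    have h4 := mul_le_mul_of_nonneg_left h1 (Real.exp_pos (-x)).le
    rw [Finset.sum_range_succ, pow_succ _ (n + 1)]
    linarith

theorem cdf_gammaMeasure_natCast_le_cdf_expMeasure_pow {p : ℕ} (hp : 1 ≤ p) {r s x y : ℝ}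
    (hr : 0 < r) (hs : 0 < s) (hx : 0 ≤ x) (hy : 0 ≤ y) (hxy : r * x ≤ s * y) :
    cdf (gammaMeasure p r) x ≤ cdf (expMeasure s) y ^ p := by
  obtain ⟨n, rfl⟩ := Nat.exists_eq_add_of_le' hp
  rw [cdf_gammaMeasure_natCast_succ n hr hx, cdf_expMeasure_eq hs, if_pos hy]
  refine (erlang_le_one_sub_exp_neg_pow n (by positivity)).trans ?_
  have h : Real.exp (-(s * y)) ≤ Real.exp (-(r * x)) := Real.exp_le_exp.2 (by linarith)
  have h1 : Real.exp (-(r * x)) ≤ 1 := Real.exp_le_one_iff.2 (by nlinarith [mul_nonneg hr.le hx])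
  exact pow_le_pow_left₀ (by linarith) (by linarith) _

/-! ### The non-central chi-square distribution -/

/-- The standard Gaussian mass of an interval of fixed length decreases as its centre moves away
from the origin. -/
theorem gaussianReal_Icc_antitone_shift {s s' t : ℝ} (hs : 0 ≤ s) (hss' : s ≤ s') :
    gaussianReal 0 1 (Set.Icc (-t - s') (t - s')) ≤ gaussianReal 0 1 (Set.Icc (-t - s) (t - s)) := by
  rcases lt_or_ge t 0 with ht | ht
  · rw [Set.Icc_eq_empty (by linarith)]
    simp
  set φ := gaussianPDFReal 0 1 with hφ
  have hφc : Continuous φ := by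
    rw [hφ, gaussianPDFReal_def]
    fun_prop
  have hi : ∀ a b : ℝ, IntervalIntegrable φ volume a b := fun a b => hφc.intervalIntegrable _ _
  have hI : ∀ u : ℝ, gaussianReal 0 1 (Set.Icc (-t - u) (t - u)) =
      ENNReal.ofReal (∫ x in (-t - u)..(t - u), φ x) := fun u => by
    rw [gaussianReal_apply_eq_integral 0 one_ne_zero, integral_Icc_eq_integral_Ioc,
      intervalIntegral.integral_of_le (by linarith)]
  rw [hI, hI]
  refine ENNReal.ofReal_le_ofReal ?_
  -- the two masses differ by those of `[t - s', t - s]` and of its translate by `-2 t`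
  have key : ∫ x in (-t - s')..(-t - s), φ x ≤ ∫ x in (t - s')..(t - s), φ x := by
    have : ∫ x in (t - s')..(t - s), φ (x - 2 * t) = ∫ x in (-t - s')..(-t - s), φ x := by
      rw [intervalIntegral.integral_comp_sub_right]
      congr 1 <;> ring
    rw [← this]
    refine intervalIntegral.integral_mono_on (by linarith)
      ((hφc.comp (by fun_prop : Continuous fun x : ℝ => x - 2 * t)).intervalIntegrable _ _)
      (hi _ _) fun x hx => ?_
    simp only [hφ, gaussianPDFReal_def]
    refine mul_le_mul_of_nonneg_left (Real.exp_le_exp.2 ?_) (by positivity)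
    simp only [sub_zero, NNReal.coe_one, mul_one]
    have hx2 := hx.2
    nlinarith
  have h1 := intervalIntegral.integral_add_adjacent_intervals (hi (-t - s') (-t - s))
    (hi (-t - s) (t - s))
  have h2 := intervalIntegral.integral_add_adjacent_intervals (hi (-t - s') (t - s'))
    (hi (t - s') (t - s))
  linarith

theorem measurable_sum_add_sqrt_sq (p : ℕ) :
    Measurable fun q : ℝ × (Fin p → ℝ) =>
      ∑ i : Fin p, (q.2 i + if (i : ℕ) = 0 then Real.sqrt q.1 else 0) ^ 2 := by
  refine Finset.measurable_sum _ fun i _ => ?_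
  split_ifs <;> fun_prop

instance isProbabilityMeasure_nonCentralChiSq (p : ℕ) (μ : ℝ) :
    IsProbabilityMeasure (nonCentralChiSq p μ) :=
  Measure.isProbabilityMeasure_map
    ((measurable_sum_add_sqrt_sq p).comp measurable_prodMk_left).aemeasurable

theorem cdf_nonCentralChiSq (p : ℕ) (μ x : ℝ) :
    cdf (nonCentralChiSq p μ) x = (Measure.pi fun _ : Fin p => gaussianReal 0 1).real
      {z | ∑ i : Fin p, (z i + if (i : ℕ) = 0 then Real.sqrt μ else 0) ^ 2 ≤ x} := by
  have hm : Measurable fun z : Fin p → ℝ =>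
      ∑ i : Fin p, (z i + if (i : ℕ) = 0 then Real.sqrt μ else 0) ^ 2 :=
    (measurable_sum_add_sqrt_sq p).comp measurable_prodMk_left
  rw [cdf_eq_real, nonCentralChiSq, map_measureReal_apply hm measurableSet_Iic]
  rfl

/-- The non-central chi-square distribution is stochastically increasing in the non-centrality. -/
theorem cdf_nonCentralChiSq_antitone {p : ℕ} (hp : 1 ≤ p) {μ μ' : ℝ} (h : μ ≤ μ') (x : ℝ) :
    cdf (nonCentralChiSq p μ') x ≤ cdf (nonCentralChiSq p μ) x := by
  obtain ⟨n, rfl⟩ := Nat.exists_eq_add_of_le' hp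
  -- condition on all coordinates but the shifted one
  have hsplit : ∀ ν : ℝ, (Measure.pi fun _ : Fin (n + 1) => gaussianReal 0 1)
      {z | ∑ i : Fin (n + 1), (z i + if (i : ℕ) = 0 then Real.sqrt ν else 0) ^ 2 ≤ x} =
      ∫⁻ w : Fin n → ℝ, gaussianReal 0 1 {u | (u + Real.sqrt ν) ^ 2 + ∑ i, w i ^ 2 ≤ x}
        ∂(Measure.pi fun _ : Fin n => gaussianReal 0 1) := by
    intro ν
    have hm : MeasurableSet
        {q : ℝ × (Fin n → ℝ) | (q.1 + Real.sqrt ν) ^ 2 + ∑ i, q.2 i ^ 2 ≤ x} :=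
      measurableSet_le (by fun_prop) measurable_const
    have hmp := measurePreserving_piFinSuccAbove (fun _ : Fin (n + 1) => gaussianReal 0 1) 0
    have := hmp.measure_preimage hm.nullMeasurableSet
    rw [Measure.prod_apply_symm hm] at this
    refine Eq.trans ?_ this
    congr 1
    ext z
    simp [Fin.sum_univ_succ, Fin.tail]
  rw [cdf_nonCentralChiSq, cdf_nonCentralChiSq]
  refine ENNReal.toReal_mono (measure_ne_top _ _) ?_
  rw [hsplit, hsplit]
  refine lintegral_mono fun w => ?_
  have hset : ∀ s : ℝ, {u : ℝ | (u + s) ^ 2 + ∑ i, w i ^ 2 ≤ x} =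
      if 0 ≤ x - ∑ i, w i ^ 2 then
        Set.Icc (-Real.sqrt (x - ∑ i, w i ^ 2) - s) (Real.sqrt (x - ∑ i, w i ^ 2) - s)
      else ∅ := by
    intro s
    split_ifs with h0
    · ext u
      rw [Set.mem_ofPred_eq, ← le_sub_iff_add_le, Real.sq_le h0, Set.mem_Icc]
      constructor <;> rintro ⟨h1, h2⟩ <;> constructor <;> linarith
    · ext u
      simp only [Set.mem_ofPred_eq, Set.mem_empty_iff_false, iff_false, not_le]
      nlinarith [sq_nonneg (u + s)]
  simp only [hset]
  split_ifs
  · exact gaussianReal_Icc_antitone_shift (Real.sqrt_nonneg _) (Real.sqrt_le_sqrt h)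
  · exact le_rfl

/-- The law of `‖τ + z‖²` for standard Gaussian `z` depends on `τ` through its norm only: the
reflection that sends `τ` to a multiple of the first basis vector preserves the Gaussian. -/
theorem map_norm_add_sq_stdGaussian {p : ℕ} (hp : 1 ≤ p) (τ : Vec p) :
    (stdGaussian (Vec p)).map (fun z => ‖τ + z‖ ^ 2) = nonCentralChiSq p (‖τ‖ ^ 2) := by
  set w : Vec p := ‖τ‖ • EuclideanSpace.single ⟨0, hp⟩ (1 : ℝ) with hw
  have hnorm : ‖τ‖ = ‖w‖ := by simp [hw, norm_smul]
  set ρ : Vec p ≃ₗᵢ[ℝ] Vec p := (Submodule.span ℝ {τ - w})ᗮ.reflection with hρ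
  have hρτ : ρ τ = w := Submodule.reflection_sub hnorm
  have hcomp : (fun z => ‖τ + z‖ ^ 2) = (fun z => ‖w + z‖ ^ 2) ∘ ρ := by
    funext z
    simp only [Function.comp_apply]
    rw [← hρτ, ← map_add, ρ.norm_map]
  rw [hcomp, ← Measure.map_map (by fun_prop) ρ.continuous.measurable, stdGaussian_map,
    ← map_pi_eq_stdGaussian, Measure.map_map (by fun_prop) (by fun_prop), nonCentralChiSq]
  congr 1
  funext z
  simp only [Function.comp_apply]
  rw [EuclideanSpace.real_norm_sq_eq]
  refine Finset.sum_congr rfl fun i _ => ?_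
  rw [Real.sqrt_sq (norm_nonneg τ)]
  by_cases hi : (i : ℕ) = 0
  · have : i = ⟨0, hp⟩ := Fin.ext hi
    subst this
    simp [hw, add_comm]
  · have : i ≠ ⟨0, hp⟩ := fun h => hi (by rw [h])
    simp [hw, hi, this]

theorem measurable_cdf_nonCentralChiSq (p : ℕ) :
    Measurable fun q : ℝ × ℝ => cdf (nonCentralChiSq p q.1) q.2 := by
  simp only [cdf_nonCentralChiSq]
  have hm : MeasurableSet {q : (ℝ × ℝ) × (Fin p → ℝ) |
      ∑ i : Fin p, (q.2 i + if (i : ℕ) = 0 then Real.sqrt q.1.1 else 0) ^ 2 ≤ q.1.2} :=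
    measurableSet_le ((measurable_sum_add_sqrt_sq p).comp
      (by fun_prop : Measurable fun q : (ℝ × ℝ) × (Fin p → ℝ) => (q.1.1, q.2))) (by fun_prop)
  exact (measurable_measure_prodMk_left hm).ennreal_toReal

/-- Galois connection between the upper quantile and the distribution function; it rests on the
right continuity of the latter. -/
theorem upperQuantile_le_iff (ν : Measure ℝ) {a : ℝ} (ha : 0 < a) (ha1 : a < 1) (x : ℝ) :
    upperQuantile ν a ≤ x ↔ 1 - a ≤ cdf ν x := by
  set A := {y : ℝ | 1 - a ≤ cdf ν y} with hA
  have hne : A.Nonempty := by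
    obtain ⟨y, hy⟩ := ((tendsto_cdf_atTop ν).eventually_const_le
      (show 1 - a < 1 by linarith)).exists
    exact ⟨y, hy⟩
  have hbdd : BddBelow A := by
    obtain ⟨y, hy⟩ := ((tendsto_cdf_atBot ν).eventually_lt_const
      (show 0 < 1 - a by linarith)).exists
    refine ⟨y, fun z hz => ?_⟩
    by_contra hlt
    have h1 : cdf ν z ≤ cdf ν y := monotone_cdf ν (not_le.1 hlt).le
    have h2 : 1 - a ≤ cdf ν z := hz
    linarith
  have hmem : 1 - a ≤ cdf ν (sInf A) := by
    have hr : Filter.Tendsto (cdf ν) (nhdsWithin (sInf A) (Set.Ioi (sInf A)))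
        (nhds (cdf ν (sInf A))) :=
      ((cdf ν).right_continuous _).mono_left (nhdsWithin_mono _ Set.Ioi_subset_Ici_self)
    refine ge_of_tendsto hr ?_
    filter_upwards [self_mem_nhdsWithin] with y hy
    obtain ⟨z, hz, hzy⟩ := exists_lt_of_csInf_lt hne hy
    exact le_trans hz (monotone_cdf ν hzy.le)
  refine ⟨fun h => hmem.trans (monotone_cdf ν h), fun h => csInf_le hbdd h⟩

theorem Measurable.cdf_nonCentralChiSq {α : Type*} [MeasurableSpace α] {f g : α → ℝ}
    (hf : Measurable f) (hg : Measurable g) (p : ℕ) :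
    Measurable fun y => cdf (nonCentralChiSq p (f y)) (g y) := by
  have h := (measurable_cdf_nonCentralChiSq p).comp (hf.prodMk hg)
  simpa only [Function.comp_def] using h

theorem measurable_ncQuantile {p : ℕ} {a : ℝ} (ha : 0 < a) (ha1 : a < 1) :
    Measurable (ncQuantile a : Vec p → ℝ) := by
  refine measurable_of_Iic fun x => ?_
  have : ncQuantile a ⁻¹' Set.Iic x =
      {τ : Vec p | 1 - a ≤ cdf (nonCentralChiSq p (‖τ‖ ^ 2)) x} := by
    ext τ
    rw [Set.mem_preimage, Set.mem_Iic, ncQuantile, upperQuantile_le_iff _ ha ha1 x,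
      Set.mem_ofPred_eq]
  rw [this]
  exact measurableSet_le measurable_const
    (Measurable.cdf_nonCentralChiSq (by fun_prop) measurable_const p)

theorem Measurable.residualStatCDF {α : Type*} [MeasurableSpace α] {p : ℕ} (σ : ℝ) {τ : α → Vec p}
    {x : α → ℝ} (hτ : Measurable τ) (hx : Measurable x) :
    Measurable fun y => residualStatCDF σ (τ y) (x y) :=
  Measurable.cdf_nonCentralChiSq ((hτ.norm.pow_const 2).div_const _) (hx.div_const _) p

theorem residualStatCDF_antitone {p : ℕ} (hp : 1 ≤ p) (σ : ℝ) {τ τ' : Vec p}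
    (h : ‖τ‖ ≤ ‖τ'‖) (x : ℝ) : residualStatCDF σ τ' x ≤ residualStatCDF σ τ x := by
  refine cdf_nonCentralChiSq_antitone hp ?_ _
  gcongr

/-- `residualStatCDF` is the distribution function of `‖τ + σ z‖²` for standard Gaussian `z`. -/
theorem residualStatCDF_eq_real {p : ℕ} (hp : 1 ≤ p) {σ : ℝ} (hσ : 0 < σ) (τ : Vec p) (x : ℝ) :
    residualStatCDF σ τ x =
      ((stdGaussian (Vec p)).map fun z => σ • z).real {y | ‖τ + y‖ ^ 2 ≤ x} := by
  have hnorm : ‖τ‖ ^ 2 / σ ^ 2 = ‖σ⁻¹ • τ‖ ^ 2 := by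
    rw [norm_smul, mul_pow, norm_inv, inv_pow, Real.norm_eq_abs, sq_abs]
    ring
  rw [residualStatCDF, hnorm, ← map_norm_add_sq_stdGaussian hp]
  have : IsProbabilityMeasure ((stdGaussian (Vec p)).map fun z => ‖σ⁻¹ • τ + z‖ ^ 2) :=
    Measure.isProbabilityMeasure_map (by fun_prop)
  rw [cdf_eq_real, map_measureReal_apply (by fun_prop) measurableSet_Iic,
    map_measureReal_apply (by fun_prop) (measurableSet_le (by fun_prop) measurable_const)]
  congr 1
  ext z
  simp only [Set.mem_preimage, Set.mem_Iic, Set.mem_ofPred_eq]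
  have hz : τ + σ • z = σ • (σ⁻¹ • τ + z) := by
    rw [smul_add, smul_inv_smul₀ hσ.ne']
  rw [hz, norm_smul, mul_pow, Real.norm_eq_abs, sq_abs, le_div_iff₀' (by positivity)]

/-! ### Conditioning on the covariance phase -/

/-- A vector of independent `N(0, σ²)` coordinates is `σ` times a standard Gaussian vector. -/
theorem map_eq_map_smul_stdGaussian {Ω : Type*} {mΩ : MeasurableSpace Ω} {P : Measure Ω}
    [IsProbabilityMeasure P] {p : ℕ} {σ : ℝ} {e : Ω → Vec p} (he : Measurable e)
    (he_law : ∀ i, HasLaw (fun ω => e ω i) (gaussianReal 0 (Real.toNNReal (σ ^ 2))) P)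
    (he_indep : iIndepFun (fun i ω => e ω i) P) :
    P.map e = (stdGaussian (Vec p)).map fun z => σ • z := by
  have hmeas : ∀ i, AEMeasurable (fun ω => e ω i) P := fun i => by fun_prop
  have hpi := (iIndepFun_iff_map_fun_eq_pi_map hmeas).1 he_indep
  have hg : gaussianReal 0 (Real.toNNReal (σ ^ 2)) = (gaussianReal 0 1).map (σ * ·) := by
    rw [gaussianReal_map_const_mul]
    congr 1
    · simp
    · ext
      simp [sq_nonneg]
  simp only [fun i => (he_law i).map_eq, hg] at hpi
  rw [← Measure.pi_map_pi (fun _ => by fun_prop)] at hpi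
  have he' : e = WithLp.toLp 2 ∘ fun ω i => e ω i := rfl
  rw [he', ← Measure.map_map (by fun_prop) (by fun_prop), hpi, ← map_pi_eq_stdGaussian,
    Measure.map_map (by fun_prop) (by fun_prop), Measure.map_map (by fun_prop) (by fun_prop)]
  rfl

/-- Conditionally on one of two independent variables, the other one keeps its law. -/
theorem condExp_indicator_ae_eq_of_indepFun {Ω α β : Type*} {mΩ : MeasurableSpace Ω}
    [MeasurableSpace α] [MeasurableSpace β] [StandardBorelSpace β] [Nonempty β]
    {P : Measure Ω} [IsProbabilityMeasure P] {X : Ω → α} {Y : Ω → β}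
    (hX : Measurable X) (hY : Measurable Y) (hXY : IndepFun X Y P)
    {A : Set (α × β)} (hA : MeasurableSet A) :
    P⟦{ω | (X ω, Y ω) ∈ A} | MeasurableSpace.comap X inferInstance⟧ =ᵐ[P]
      fun ω => (P.map Y).real {y | (X ω, y) ∈ A} := by
  have hYp : IsProbabilityMeasure (P.map Y) := Measure.isProbabilityMeasure_map hY.aemeasurable
  have hconst : condDistrib Y X P =ᵐ[P.map X] Kernel.const α (P.map Y) := by
    refine condDistrib_ae_eq_of_measure_eq_compProd X hY.aemeasurable ?_
    rw [Measure.compProd_const]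
    exact (indepFun_iff_map_prod_eq_prod_map_map hX.aemeasurable hY.aemeasurable).1 hXY
  have hf : StronglyMeasurable (A.indicator fun _ => (1 : ℝ)) :=
    stronglyMeasurable_const.indicator hA
  have hpre : MeasurableSet {ω | (X ω, Y ω) ∈ A} := (hX.prodMk hY) hA
  have hcomp : ({ω | (X ω, Y ω) ∈ A}.indicator fun _ => (1 : ℝ)) =
      fun ω => A.indicator (fun _ => (1 : ℝ)) (X ω, Y ω) := by
    rfl
  have hint : Integrable (fun ω => A.indicator (fun _ => (1 : ℝ)) (X ω, Y ω)) P := by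
    rw [← hcomp]
    exact (integrable_const (1 : ℝ)).indicator hpre
  have hcond := condExp_prod_ae_eq_integral_condDistrib hX hY.aemeasurable hf hint
  rw [← hcomp] at hcond
  filter_upwards [hcond, ae_of_ae_map hX.aemeasurable hconst] with ω h1 h2
  rw [h1, h2, Kernel.const_apply]
  exact integral_indicator_one (measurable_prodMk_left hA)

/-- Given the covariance phase, the alarm probability is the mass that the noisy statistic puts
above the rejection threshold. -/
theorem condExp_dpAlarm_ae_eq {Ω α : Type*} {mΩ : MeasurableSpace Ω} [MeasurableSpace α]
    {P : Measure Ω} [IsProbabilityMeasure P] {p : ℕ} (hp : 1 ≤ p) {σ a : ℝ} (hσ : 0 < σ)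
    (ha : 0 < a) (ha1 : a < 1) {X : Ω → α} (hX : Measurable X) {g : α → Vec p}
    (hg : Measurable g) {e : Ω → Vec p} (he : Measurable e)
    (he_law : ∀ i, HasLaw (fun ω => e ω i) (gaussianReal 0 (Real.toNNReal (σ ^ 2))) P)
    (he_indep : iIndepFun (fun i ω => e ω i) P) (hXe : IndepFun X e P) :
    P⟦dpAlarm σ a (fun ω => g (X ω)) e | MeasurableSpace.comap X inferInstance⟧ =ᵐ[P]
      fun ω => 1 - residualStatCDF σ (g (X ω)) (σ ^ 2 * ncQuantile a (g (X ω))) := by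
  have hq : Measurable fun q : α × Vec p => σ ^ 2 * ncQuantile a (g q.1) :=
    ((measurable_ncQuantile ha ha1).comp (hg.comp measurable_fst)).const_mul _
  have hA : MeasurableSet
      {q : α × Vec p | σ ^ 2 * ncQuantile a (g q.1) < ‖g q.1 + q.2‖ ^ 2} :=
    measurableSet_lt hq (((hg.comp measurable_fst).add measurable_snd).norm.pow_const 2)
  filter_upwards [condExp_indicator_ae_eq_of_indepFun hX he hXe hA] with ω hω
  refine hω.trans ?_
  have hep : IsProbabilityMeasure (P.map e) := Measure.isProbabilityMeasure_map he.aemeasurable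
  rw [residualStatCDF_eq_real hp hσ, ← map_eq_map_smul_stdGaussian he he_law he_indep,
    ← probReal_compl_eq_one_sub (measurableSet_le (by fun_prop) measurable_const)]
  congr 1
  ext y
  simp

/-! ### The worst-case bound -/

/-- A centred Gaussian vector with positive definite covariance matrix is almost surely nonzero. -/
theorem ae_ne_zero_of_hasLaw_multivariateGaussian {Ω : Type*} {mΩ : MeasurableSpace Ω}
    {P : Measure Ω} {d : ℕ} (hd : 0 < d) {S : Matrix (Fin d) (Fin d) ℝ} (hS : S.PosDef)
    {r : Ω → Vec d} (hr_law : HasLaw r (multivariateGaussian 0 S) P) :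
    ∀ᵐ ω ∂P, r ω ≠ 0 := by
  have hmp := measurePreserving_eval_multivariateGaussian (μ := (0 : Vec d)) hS.posSemidef
    (i := ⟨0, hd⟩)
  have hv : (S ⟨0, hd⟩ ⟨0, hd⟩).toNNReal ≠ 0 := by
    rw [ne_eq, Real.toNNReal_eq_zero, not_le]
    exact hS.diag_pos
  have := nullSingletonClass_gaussianReal (μ := (0 : Vec d) ⟨0, hd⟩) hv
  have h0 : ∀ᵐ x ∂multivariateGaussian 0 S, x ⟨0, hd⟩ ≠ 0 := by
    refine hmp.quasiMeasurePreserving.ae (p := fun y => y ≠ 0) ?_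
    rw [ae_iff]
    simp only [ne_eq, not_not]
    exact measure_singleton 0
  rw [← hr_law.map_eq] at h0
  filter_upwards [ae_of_ae_map hr_law.aemeasurable h0] with ω h1 h2
  exact h1 (by rw [h2]; rfl)

theorem measurable_residualEnergy {Ω : Type*} {mΩ : MeasurableSpace Ω} {p d : ℕ} (hpd : p ≤ d)
    {B : Ω → OrthonormalBasis (Fin d) ℝ (Vec d)} (hB : ∀ i, Measurable fun ω => B ω i)
    {r : Ω → Vec d} (hr : Measurable r) :
    Measurable fun ω => residualEnergy hpd (B ω) (r ω) :=
  Finset.measurable_sum _ fun _ _ => ((hB _).inner hr).pow_const 2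

theorem residualEnergy_nonneg {p d : ℕ} (hpd : p ≤ d)
    (B : OrthonormalBasis (Fin d) ℝ (Vec d)) (r : Vec d) : 0 ≤ residualEnergy hpd B r :=
  Finset.sum_nonneg fun _ _ => sq_nonneg _

theorem residualEnergy_le_norm_sq {p d : ℕ} (hpd : p ≤ d)
    (B : OrthonormalBasis (Fin d) ℝ (Vec d)) (r : Vec d) : residualEnergy hpd B r ≤ ‖r‖ ^ 2 := by
  rw [← B.sum_sq_inner_right r, residualEnergy]
  exact (Finset.sum_map Finset.univ (Fin.castLEEmb hpd) fun j => inner ℝ (B j) r ^ 2).symm.le.trans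
    (Finset.sum_le_sum_of_subset_of_nonneg (Finset.subset_univ _) fun _ _ _ => sq_nonneg _)

theorem covThreshold_pos {d : ℕ} (hd : 1 ≤ d) {Δ ε γ : ℝ} (hΔ : 0 < Δ) (hε : 0 < ε) (hγ : 0 < γ)
    (hγ1 : γ < 1) : 0 < covThreshold d Δ ε γ := by
  have hd' : (1 : ℝ) ≤ d := by exact_mod_cast hd
  exact mul_pos (div_pos hΔ hε) (Real.log_pos ((one_lt_div hγ).2 (by linarith)))

/-- The bound dominates the exact conditional alarm probability. Since
`R θ ε / (Δ ‖rmax‖²) ≤ θ ε / Δ`, the factor `F^{gamma}(R θ)` is at most `F^{ex}(θ)ᵖ`, and the loss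
in the first summand is made up for by the second one. -/
theorem one_sub_residualStatCDF_le_typeIBound {p d : ℕ} (hp : 1 ≤ p) {σ a Δ ε θ R : ℝ}
    (hΔ : 0 < Δ) (hε : 0 < ε) (hθ : 0 ≤ θ) (hR : 0 ≤ R) {rmax : Vec d} (hrmax : rmax ≠ 0)
    (hRr : R ≤ ‖rmax‖ ^ 2) {τ τmax : Vec p} (hτ : ‖τ‖ ≤ ‖τmax‖) :
    1 - residualStatCDF σ τ (σ ^ 2 * ncQuantile a τ) ≤
      typeIBound σ a Δ ε θ R rmax τ τmax := by
  have hn : 0 < ‖rmax‖ := norm_pos_iff.2 hrmax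
  have hgamma : cdf (gammaMeasure p (ε / (Δ * ‖rmax‖ ^ 2))) (R * θ) ≤
      cdf (expMeasure (ε / Δ)) θ ^ p := by
    refine cdf_gammaMeasure_natCast_le_cdf_expMeasure_pow hp (by positivity) (by positivity)
      (by positivity) hθ ?_
    rw [div_mul_eq_mul_div, div_le_iff₀ (by positivity)]
    have : ε / Δ * θ * (Δ * ‖rmax‖ ^ 2) = ε * (‖rmax‖ ^ 2 * θ) := by
      field_simp
    rw [this]
    gcongr
  have hmono := residualStatCDF_antitone hp σ hτ (σ ^ 2 * ncQuantile a τ)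
  have h1 : residualStatCDF σ τ (σ ^ 2 * ncQuantile a τ) ≤ 1 := cdf_le_one _ _
  have h2 : 0 ≤ cdf (expMeasure (ε / Δ)) θ ^ p := pow_nonneg (cdf_nonneg _ _) _
  rw [typeIBound]
  nlinarith [mul_le_mul_of_nonneg_right hgamma (sub_nonneg.2 h1),
    mul_le_mul_of_nonneg_left hmono h2]

theorem norm_typeIBound_le {p d : ℕ} (σ a Δ ε θ R : ℝ) (rmax : Vec d) (τ τmax : Vec p) :
    ‖typeIBound σ a Δ ε θ R rmax τ τmax‖ ≤ 2 := by
  have hc : ∀ (ν : Measure ℝ) (x : ℝ), 1 - cdf ν x ∈ Set.Icc (0 : ℝ) 1 := fun ν x =>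
    ⟨sub_nonneg.2 (cdf_le_one ν x), sub_le_self _ (cdf_nonneg ν x)⟩
  have hg := hc (gammaMeasure p (ε / (Δ * ‖rmax‖ ^ 2))) (R * θ)
  have hτ : 1 - residualStatCDF σ τ (σ ^ 2 * ncQuantile a τ) ∈ Set.Icc (0 : ℝ) 1 := hc _ _
  have hm : 1 - residualStatCDF σ τmax (σ ^ 2 * ncQuantile a τ) ∈ Set.Icc (0 : ℝ) 1 := hc _ _
  have he0 : 0 ≤ cdf (expMeasure (ε / Δ)) θ ^ p := pow_nonneg (cdf_nonneg _ _) _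
  have he1 : cdf (expMeasure (ε / Δ)) θ ^ p ≤ 1 := pow_le_one₀ (cdf_nonneg _ _) (cdf_le_one _ _)
  rw [typeIBound, Real.norm_of_nonneg (add_nonneg (mul_nonneg hg.1 hτ.1) (mul_nonneg he0 hm.1))]
  linarith [mul_le_one₀ hg.2 hτ.1 hτ.2, mul_le_one₀ he1 hm.1 hm.2]

/-- Off the null event `rmax = 0` the gamma factor has its closed form, which is measurable in
`rmax` and `R`. -/
theorem aestronglyMeasurable_typeIBound {Ω : Type*} {mΩ : MeasurableSpace Ω} {P : Measure Ω}
    {p d : ℕ} (hp : 1 ≤ p) {σ a Δ ε θ : ℝ} (ha : 0 < a) (ha1 : a < 1) (hΔ : 0 < Δ)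
    (hε : 0 < ε) (hθ : 0 ≤ θ) {R : Ω → ℝ} (hR : Measurable R) (hR0 : ∀ ω, 0 ≤ R ω)
    {rmax : Ω → Vec d} (hrmax : Measurable rmax) (hrmax0 : ∀ᵐ ω ∂P, rmax ω ≠ 0)
    {τ τmax : Ω → Vec p} (hτ : Measurable τ) (hτmax : Measurable τmax) :
    AEStronglyMeasurable (fun ω => typeIBound σ a Δ ε θ (R ω) (rmax ω) (τ ω) (τmax ω)) P := by
  obtain ⟨n, rfl⟩ := Nat.exists_eq_add_of_le' hp
  have hq : Measurable fun ω => σ ^ 2 * ncQuantile a (τ ω) :=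
    ((measurable_ncQuantile ha ha1).comp hτ).const_mul _
  have hgamma : AEMeasurable
      (fun ω => cdf (gammaMeasure ((n + 1 : ℕ) : ℝ) (ε / (Δ * ‖rmax ω‖ ^ 2))) (R ω * θ)) P := by
    refine ⟨fun ω => 1 - Real.exp (-(ε / (Δ * ‖rmax ω‖ ^ 2) * (R ω * θ))) *
      ∑ k ∈ Finset.range (n + 1), (ε / (Δ * ‖rmax ω‖ ^ 2) * (R ω * θ)) ^ k / (k.factorial : ℝ),
      by fun_prop, ?_⟩
    filter_upwards [hrmax0] with ω hω
    have hn : 0 < ‖rmax ω‖ := norm_pos_iff.2 hω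
    exact cdf_gammaMeasure_natCast_succ n (by positivity) (mul_nonneg (hR0 ω) hθ)
  have h1 := Measurable.residualStatCDF σ hτ hq
  have h2 := Measurable.residualStatCDF σ hτmax hq
  exact (((aemeasurable_const.sub hgamma).mul (h1.const_sub 1).aemeasurable).add
    ((h2.const_sub 1).const_mul _).aemeasurable).aestronglyMeasurable

/-! ### Type-I error of the test -/

theorem mainTheorem1
    {Ω : Type*} [mΩ : MeasurableSpace Ω] (P : Measure Ω) [IsProbabilityMeasure P]
    -- dimensions, privacy parameters and level of the test
    (p d : ℕ) (hp : 1 ≤ p) (hpd : p ≤ d)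
    (σ Δ ε γ a : ℝ) (hσ : 0 < σ) (hΔ : 0 < Δ) (hε : 0 < ε)
    (hγ : 0 < γ) (hγ1 : γ < 1) (ha : 0 < a) (ha1 : a < 1)
    -- residual covariance `S = V diag(lam) Vᵀ`; null hypothesis `r ∼ N(0, S)`
    (S : Matrix (Fin d) (Fin d) ℝ) (hS : S.PosDef)
    (lam : Fin d → ℝ) (V : OrthonormalBasis (Fin d) ℝ (Vec d))
    (hV : IsSpectralDecomposition S lam V)
    (r : Ω → Vec d) (hr : Measurable r) (hr_law : HasLaw r (multivariateGaussian 0 S) P)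
    -- covariance phase: disclosed eigenvectors (such as `V`) and Laplace noise on the eigenvalues
    (Vhat : Ω → OrthonormalBasis (Fin d) ℝ (Vec d))
    (hVhat : ∀ i, Measurable fun ω => Vhat ω i)
    (L : Fin d → Ω → ℝ) (hL : ∀ i, Measurable (L i))
    (hL_law : ∀ i, HasLaw (L i) (laplaceMeasure (Δ / ε)) P)
    (hL_indep : iIndepFun L P) (hLr : IndepFun r (fun ω i => L i ω) P)
    (τcov : Ω → Vec p)
    (hτcov : τcov = fun ω => covResidual hpd lam (Vhat ω) (fun i => L i ω) (r ω))
    -- residual phase: independent Gaussian noise `e ∼ N(0, σ² I)`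
    (e : Ω → Vec p) (he : Measurable e)
    (he_law : ∀ i, HasLaw (fun ω => e ω i) (gaussianReal 0 (Real.toNNReal (σ ^ 2))) P)
    (he_indep : iIndepFun (fun i ω => e ω i) P)
    (he_cov : IndepFun e
      (fun ω => (r ω, (fun i => Vhat ω i : Fin d → Vec d), fun i => L i ω)) P)
    -- orthonormal coordinates in which `R_t` is computed (such as `V`, `Vhat` or the standard ones)
    (B : Ω → OrthonormalBasis (Fin d) ℝ (Vec d)) (hB : ∀ i, Measurable fun ω => B ω i)
    -- worst-case residual, and worst-case reduced residual, over the sets of admissible ones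
    (Rset : Ω → Set (Vec d)) (hRset : ∀ᵐ ω ∂P, r ω ∈ Rset ω)
    (rmax : Ω → Vec d) (hrmax : Measurable rmax)
    (hrmax_max : ∀ᵐ ω ∂P, IsNormArgmax (Rset ω) (rmax ω))
    (Tset : Ω → Set (Vec p)) (hTset : ∀ᵐ ω ∂P, τcov ω ∈ Tset ω)
    (τmax : Ω → Vec p) (hτmax : Measurable τmax)
    (hτmax_max : ∀ᵐ ω ∂P, IsNormArgmax (Tset ω) (τmax ω))
    (bound : Ω → ℝ)
    (hbound : bound = fun ω => typeIBound σ a Δ ε (covThreshold d Δ ε γ)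
      (residualEnergy hpd (B ω) (r ω)) (rmax ω) (τcov ω) (τmax ω)) :
    MeasurableSet (dpAlarm σ a τcov e) ∧ Integrable bound P ∧
      -- given the outcome of the covariance phase
      P⟦dpAlarm σ a τcov e | covPhase r Vhat L⟧ ≤ᵐ[P] bound ∧
      -- given any part of it, for instance the residual alone
      (∀ m : MeasurableSpace Ω, m ≤ covPhase r Vhat L →
        P⟦dpAlarm σ a τcov e | m⟧ ≤ᵐ[P] P[bound | m]) ∧
      -- unconditionally
      P.real (dpAlarm σ a τcov e) ≤ ∫ ω, bound ω ∂P := by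
  have hd : 0 < d := by omega
  set X : Ω → Vec d × (Fin d → Vec d) × (Fin d → ℝ) :=
    fun ω => (r ω, (fun i => Vhat ω i : Fin d → Vec d), fun i => L i ω) with hX_def
  have hX : Measurable X :=
    hr.prodMk ((measurable_pi_lambda _ hVhat).prodMk (measurable_pi_lambda _ hL))
  -- the reduced residual is a function of the outcome of the covariance phase
  set g : Vec d × (Fin d → Vec d) × (Fin d → ℝ) → Vec p := fun q =>
    WithLp.toLp 2 fun i : Fin p =>
      ((Real.sqrt (lam (Fin.castLE hpd i)))⁻¹ + q.2.2 (Fin.castLE hpd i)) *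
        inner ℝ (q.2.1 (Fin.castLE hpd i)) q.1 with hg_def
  have hg : Measurable g := by
    refine (WithLp.measurable_toLp 2 _).comp (measurable_pi_lambda _ fun i => ?_)
    exact (by fun_prop : Measurable fun q : Vec d × (Fin d → Vec d) × (Fin d → ℝ) =>
      (Real.sqrt (lam (Fin.castLE hpd i)))⁻¹ + q.2.2 (Fin.castLE hpd i)).mul
      (((measurable_pi_apply _).comp (measurable_fst.comp measurable_snd)).inner measurable_fst)
  have hτ_eq : τcov = fun ω => g (X ω) := hτcov
  have hτ : Measurable τcov := hτ_eq ▸ hg.comp hX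
  have hθ : 0 ≤ covThreshold d Δ ε γ := (covThreshold_pos hd hΔ hε hγ hγ1).le
  have hcond : P⟦dpAlarm σ a τcov e | covPhase r Vhat L⟧ =ᵐ[P]
      fun ω => 1 - residualStatCDF σ (τcov ω) (σ ^ 2 * ncQuantile a (τcov ω)) := by
    rw [hτ_eq]
    exact condExp_dpAlarm_ae_eq hp hσ ha ha1 hX hg he he_law he_indep he_cov.symm
  have hr_le : ∀ᵐ ω ∂P, ‖r ω‖ ≤ ‖rmax ω‖ := by
    filter_upwards [hRset, hrmax_max] with ω h1 h2 using h2.2 _ h1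
  have hτ_le : ∀ᵐ ω ∂P, ‖τcov ω‖ ≤ ‖τmax ω‖ := by
    filter_upwards [hTset, hτmax_max] with ω h1 h2 using h2.2 _ h1
  have hrmax0 : ∀ᵐ ω ∂P, rmax ω ≠ 0 := by
    filter_upwards [hr_le, ae_ne_zero_of_hasLaw_multivariateGaussian hd hS hr_law] with ω h1 h2
    exact norm_pos_iff.1 ((norm_pos_iff.2 h2).trans_le h1)
  have hA : MeasurableSet (dpAlarm σ a τcov e) :=
    measurableSet_lt (((measurable_ncQuantile ha ha1).comp hτ).const_mul _)
      ((hτ.add he).norm.pow_const 2)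
  have hbound_int : Integrable bound P := by
    rw [hbound]
    refine Integrable.of_bound (aestronglyMeasurable_typeIBound hp ha ha1 hΔ hε hθ
      (measurable_residualEnergy hpd hB hr) (fun ω => residualEnergy_nonneg hpd _ _) hrmax hrmax0
      hτ hτmax) 2 (ae_of_all _ fun ω => norm_typeIBound_le ..)
  have hle : P⟦dpAlarm σ a τcov e | covPhase r Vhat L⟧ ≤ᵐ[P] bound := by
    filter_upwards [hcond, hr_le, hτ_le, hrmax0] with ω h1 h2 h3 h4
    rw [h1, hbound]
    refine one_sub_residualStatCDF_le_typeIBound hp hΔ hε hθ (residualEnergy_nonneg hpd _ _) h4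
      ((residualEnergy_le_norm_sq hpd _ _).trans ?_) h3
    gcongr
  have hsub : covPhase r Vhat L ≤ mΩ := hX.comap_le
  refine ⟨hA, hbound_int, hle, fun m hm => ?_, ?_⟩
  · exact (condExp_condExp_of_le hm hsub).symm.le.trans
      (condExp_mono integrable_condExp hbound_int hle)
  · have hint := integral_mono_ae integrable_condExp hbound_int hle
    rwa [integral_condExp hsub, integral_indicator_const _ hA, smul_eq_mul, mul_one] at hint
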